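/- Let $\Lambda$ be a finite set and let $\Phi=\{\varphi_i\}_{i\in\Lambda}$, $\varphi_i(x)=A_ix+b_i$, be a system of invertible affine contractions of $\mathbb{R}^2$ (with the Euclidean norm) such that - the maps $\varphi_i$ have no common fixed point; - $\Phi$ is non-conformal: there is no affine coordinate system of $\mathbb{R}^2$ in which all the maps $\varphi_i$ are similarities; - $\Phi$ is totally irreducible: there is no non-empty finite set of lines through the origin of $\mathbb{R}^2$ which is invariant under all of the matrices $A_i$. Let $p=(p_i)_{i\in\Lambda}$ be a probability vector with $p_i>0$ for all $i\in\Lambda$, and let $\mu$ be the associated self-affine measure, i.e. the unique Borel probability measure on $\mathbb{R}^2$ satisfying $\mu=\sum_{i\in\Lambda}p_i\cdot\varphi_i\mu$, where $\varphi_i\mu$ is the push-forward of $\mu$ by $\varphi_i$. Then $\mu(C)=0$ for every quadratic curve $C$, that is, for every zero set $C=\{x\in\mathbb{R}^2: P(x)=0\}$ of a polynomial $0\neq P\in\mathbb{R}[x,y]$ of degree at most $2$. -/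

import Mathlib

open MeasureTheory

/-- The Euclidean plane, with the Euclidean norm. -/
abbrev Plane : Type := EuclideanSpace ℝ (Fin 2)

/-- `f` is a similarity: it multiplies all Euclidean distances by one positive constant. -/
def IsSimilarity (f : Plane → Plane) : Prop :=
  ∃ r : ℝ, 0 < r ∧ ∀ x y : Plane, dist (f x) (f y) = r * dist x y

/-- Every map of the system is a contraction (in the Euclidean metric). -/
def IsContractive {Λ : Type*} (Φ : Λ → (Plane ≃ᵃ[ℝ] Plane)) : Prop :=
  ∀ i, ∃ K : NNReal, ContractingWith K (Φ i)

/-- The maps of the system have no common fixed point. -/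
def NoCommonFixedPoint {Λ : Type*} (Φ : Λ → (Plane ≃ᵃ[ℝ] Plane)) : Prop :=
  ¬ ∃ x : Plane, ∀ i, Φ i x = x

/-- There is no (affine) coordinate system of the plane in which all the maps of the system are
similarities. -/
def IsNonConformal {Λ : Type*} (Φ : Λ → (Plane ≃ᵃ[ℝ] Plane)) : Prop :=
  ¬ ∃ g : Plane ≃ᵃ[ℝ] Plane, ∀ i, IsSimilarity fun x => g (Φ i (g.symm x))

/-- There is no non-empty finite set of lines through the origin which is invariant under the
linear parts of all the maps of the system. -/
def IsTotallyIrreducible {Λ : Type*} (Φ : Λ → (Plane ≃ᵃ[ℝ] Plane)) : Prop :=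
  ¬ ∃ S : Set (Submodule ℝ Plane), S.Finite ∧ S.Nonempty ∧
    (∀ ℓ ∈ S, Module.finrank ℝ ℓ = 1) ∧
    ∀ i, ∀ ℓ ∈ S, ℓ.map ((Φ i).linear : Plane →ₗ[ℝ] Plane) ∈ S

/-- `p` is a strictly positive probability vector. -/
def IsPositiveProbVector {Λ : Type*} [Fintype Λ] (p : Λ → ℝ) : Prop :=
  (∀ i, 0 < p i) ∧ ∑ i, p i = 1

/-- `μ` is the self-affine measure of the system `Φ` and the weights `p`: the Borel probability
measure satisfying `μ = ∑ i, p i • (Φ i) μ`. -/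
def IsSelfAffineMeasure {Λ : Type*} [Fintype Λ] (Φ : Λ → (Plane ≃ᵃ[ℝ] Plane)) (p : Λ → ℝ)
    (μ : Measure Plane) : Prop :=
  IsProbabilityMeasure μ ∧ μ = ∑ i, ENNReal.ofReal (p i) • μ.map (Φ i)

/-- A quadratic curve is the zero set of a nonzero real polynomial in two variables of degree at
most two. -/
def IsQuadraticCurve (C : Set Plane) : Prop :=
  ∃ P : MvPolynomial (Fin 2) ℝ, P ≠ 0 ∧ P.totalDegree ≤ 2 ∧
    C = {x : Plane | MvPolynomial.eval (fun j => x j) P = 0}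

/-! Suppose some quadratic curve has positive mass. Once points and lines are known to be null, two
distinct quadratic curves meet in a null set, so only finitely many attain the maximal mass. The
mass of such a curve is a weighted average of the masses of its preimages, so all of these are
maximal too, and each map permutes the finite family by preimage (`exists_finite_permuted_family`).

The real asymptotic directions of these curves form a finite set of lines invariant under the linear
parts, so total irreducibility leaves none. The leading forms are then definite and the curves
bounded. Their union is bounded and backward invariant under contractions, which forces its points
to be common fixed points (`fixed_of_mem_bounded_backward_invariant`): a contradiction. The same
scheme, applied to points and then to lines, gives the preliminary null statements. -/

/-- Among the members of a family of sets with null pairwise intersections, stable under preimages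
by the maps of the system, those of maximal mass form a finite family permuted by the system. -/
theorem exists_finite_permuted_family {Λ : Type*} [Fintype Λ] {Φ : Λ → (Plane ≃ᵃ[ℝ] Plane)}
    {p : Λ → ℝ} (hp : IsPositiveProbVector p) {μ : Measure Plane} (hμ : IsSelfAffineMeasure Φ p μ)
    (𝒞 : Set (Set Plane)) (hclosed : ∀ C ∈ 𝒞, IsClosed C)
    (hpre : ∀ i, ∀ C ∈ 𝒞, Φ i ⁻¹' C ∈ 𝒞)
    (hnull : ∀ C ∈ 𝒞, ∀ D ∈ 𝒞, C ≠ D → μ (C ∩ D) = 0)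
    {C₀ : Set Plane} (hC₀ : C₀ ∈ 𝒞) (hpos : μ C₀ ≠ 0) :
    ∃ S ⊆ 𝒞, S.Finite ∧ S.Nonempty ∧ (∀ C ∈ S, μ C ≠ 0) ∧
      (∀ i, ∀ C ∈ S, Φ i ⁻¹' C ∈ S) ∧ ∀ i, ∀ C ∈ S, ∃ D ∈ S, Φ i ⁻¹' D = C := by
  obtain ⟨hprob, hμ⟩ := hμ
  have hfin : ∀ ε : ENNReal, 0 < ε → {C ∈ 𝒞 | ε ≤ μ C}.Finite := by
    intro ε hε
    have := Measure.finite_const_le_meas_of_disjoint_iUnion₀ (ι := 𝒞) μ hε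
      (As := fun C => (C : Set Plane)) (fun C => (hclosed C C.2).measurableSet.nullMeasurableSet)
      (fun C D hCD => hnull C C.2 D D.2 fun h => hCD (Subtype.ext h)) (measure_ne_top _ _)
    refine (this.image Subtype.val).subset ?_
    rintro C ⟨hC, hC'⟩
    exact ⟨⟨C, hC⟩, hC', rfl⟩
  obtain ⟨M, ⟨hM, hM₀⟩, hmax⟩ := Set.exists_max_image _ (fun C => μ C)
    (hfin (μ C₀) (pos_iff_ne_zero.2 hpos)) ⟨C₀, hC₀, le_rfl⟩
  have hle : ∀ C ∈ 𝒞, μ C ≤ μ M := fun C hC => by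
    by_cases h : μ C₀ ≤ μ C
    · exact hmax C ⟨hC, h⟩
    · exact (not_le.1 h).le.trans hM₀
  have hMpos : 0 < μ M := (pos_iff_ne_zero.2 hpos).trans_le hM₀
  set S : Set (Set Plane) := {C ∈ 𝒞 | μ C = μ M} with hS
  have hSfin : S.Finite := (hfin (μ M) hMpos).subset fun C hC => ⟨hC.1, hC.2.ge⟩
  have hstab : ∀ i, ∀ C ∈ S, Φ i ⁻¹' C ∈ S := by
    rintro i C ⟨hC, hCM⟩
    refine ⟨hpre i C hC, ?_⟩
    -- An average with positive weights that equals the maximum has all its terms equal to the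
    -- maximum.
    have hreal : ∑ j, p j * (μ.real M - μ.real (Φ j ⁻¹' C)) = 0 := by
      have h1 : μ C = ∑ j, ENNReal.ofReal (p j) * μ (Φ j ⁻¹' C) := by
        conv_lhs => rw [hμ]
        simp only [Measure.coe_finsetSum, Finset.sum_apply, Measure.smul_apply, smul_eq_mul]
        refine Finset.sum_congr rfl fun j _ => ?_
        rw [Measure.map_apply (Φ j).continuous_of_finiteDimensional.measurable
          (hclosed C hC).measurableSet]
      have h2 : μ.real M = ∑ j, p j * μ.real (Φ j ⁻¹' C) := by
        rw [Measure.real, ← hCM, h1, ENNReal.toReal_sum]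
        · refine Finset.sum_congr rfl fun j _ => ?_
          rw [ENNReal.toReal_mul, ENNReal.toReal_ofReal (hp.1 j).le, Measure.real]
        · exact fun j _ => ENNReal.mul_ne_top ENNReal.ofReal_ne_top (measure_ne_top _ _)
      simp only [mul_sub, Finset.sum_sub_distrib]
      rw [← h2, ← Finset.sum_mul, hp.2, one_mul, sub_self]
    have hterm := (Finset.sum_eq_zero_iff_of_nonneg fun j _ => mul_nonneg (hp.1 j).le
      (sub_nonneg.2 (ENNReal.toReal_mono (measure_ne_top _ _) (hle _ (hpre j C hC))))).1 hreal i
      (Finset.mem_univ i)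
    have := (mul_eq_zero.1 hterm).resolve_left (hp.1 i).ne'
    exact ((ENNReal.toReal_eq_toReal_iff' (measure_ne_top _ _) (measure_ne_top _ _)).1
      (sub_eq_zero.1 this)).symm
  refine ⟨S, fun C hC => hC.1, hSfin, ⟨M, hM, rfl⟩, fun C hC => hC.2 ▸ hMpos.ne', hstab, ?_⟩
  intro i
  -- Preimage under a surjection is injective on sets, hence bijective on the finite stable family.
  have himage : (fun C => Φ i ⁻¹' C) '' S = S :=
    Set.eq_of_subset_of_ncard_le (Set.image_subset_iff.2 (hstab i))
      (Set.ncard_image_of_injective S (Set.preimage_injective.2 (Φ i).surjective)).ge hSfin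
  intro C hC
  rwa [← himage] at hC

/-- A bounded set that is backward invariant under all maps of a contractive system consists of
common fixed points. -/
theorem fixed_of_mem_bounded_backward_invariant {Λ : Type*} {Φ : Λ → (Plane ≃ᵃ[ℝ] Plane)}
    (hcontr : IsContractive Φ) {B : Set Plane} (hB : Bornology.IsBounded B)
    (hinv : ∀ i, ∀ y ∈ B, (Φ i).symm y ∈ B) {y : Plane} (hy : y ∈ B) (i : Λ) : Φ i y = y := by
  obtain ⟨K, hK⟩ := hcontr i
  obtain ⟨R, hR⟩ := (Metric.isBounded_iff_subset_ball (hK.fixedPoint (Φ i))).1 hB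
  -- Each point of `B` is the `n`-fold image of a point of `B`, which lies within `R` of the fixed
  -- point.
  have hle : ∀ n : ℕ, ∀ z ∈ B, dist z (hK.fixedPoint (Φ i)) ≤ (K : ℝ) ^ n * R := by
    intro n
    induction n with
    | zero => intro z hz; simpa using (Metric.mem_ball.1 (hR hz)).le
    | succ n ih =>
      intro z hz
      have h := hK.toLipschitzWith.dist_le_mul ((Φ i).symm z) (hK.fixedPoint (Φ i))
      rw [AffineEquiv.apply_symm_apply, hK.fixedPoint_isFixedPt.eq] at h
      calc _ ≤ _ := h
        _ ≤ K * ((K : ℝ) ^ n * R) := by gcongr; exact ih _ (hinv i z hz)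
        _ = _ := by ring
  have hlim : Filter.Tendsto (fun n : ℕ => (K : ℝ) ^ n * R) Filter.atTop (nhds 0) := by
    simpa using (tendsto_pow_atTop_nhds_zero_of_lt_one K.2 (by exact_mod_cast hK.1)).mul_const R
  have h0 : dist y (hK.fixedPoint (Φ i)) ≤ 0 := ge_of_tendsto' hlim fun n => hle n y hy
  rw [dist_le_zero.1 h0]
  exact hK.fixedPoint_isFixedPt.eq

/-! ### Points and lines are null -/

/-- The heaviest atoms would form a finite, hence bounded, backward invariant set. -/
theorem measure_singleton_eq_zero_of_isSelfAffine {Λ : Type*} [Fintype Λ]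
    {Φ : Λ → (Plane ≃ᵃ[ℝ] Plane)}
    (hcontr : IsContractive Φ) (hfix : NoCommonFixedPoint Φ) {p : Λ → ℝ}
    (hp : IsPositiveProbVector p) {μ : Measure Plane} (hμ : IsSelfAffineMeasure Φ p μ) (x : Plane) :
    μ {x} = 0 := by
  by_contra hx
  obtain ⟨S, hS, hSfin, ⟨C, hC⟩, -, hstab, -⟩ := exists_finite_permuted_family hp hμ
    (Set.range fun x : Plane => ({x} : Set Plane)) (by rintro _ ⟨x, rfl⟩; exact isClosed_singleton)
    (by
      rintro i _ ⟨x, rfl⟩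
      refine ⟨(Φ i).symm x, ?_⟩
      ext y
      simp [AffineEquiv.eq_symm_apply])
    (by
      rintro _ ⟨x, rfl⟩ _ ⟨y, rfl⟩ hxy
      have : ({x} ∩ {y} : Set Plane) = ∅ := by
        simpa using fun h : y = x => hxy (by rw [h])
      simp [this]) ⟨x, rfl⟩ hx
  obtain ⟨y, rfl⟩ := hS hC
  refine hfix ⟨y, fun i => fixed_of_mem_bounded_backward_invariant hcontr (B := ⋃₀ S)
    ((Bornology.isBounded_sUnion hSfin).2 fun D hD => ?_) ?_ (Set.mem_sUnion_of_mem (Set.mem_singleton y) hC) i⟩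
  · obtain ⟨z, rfl⟩ := hS hD
    exact Bornology.isBounded_singleton
  · rintro j z ⟨D, hD, hz⟩
    exact ⟨_, hstab j D hD, by simpa using hz⟩

/-- Distinct lines share at most one point, which is null, so the directions of the heaviest lines
would contradict total irreducibility. -/
theorem measure_line_eq_zero_of_isSelfAffine {Λ : Type*} [Fintype Λ]
    {Φ : Λ → (Plane ≃ᵃ[ℝ] Plane)}
    (hirr : IsTotallyIrreducible Φ) {p : Λ → ℝ}
    (hp : IsPositiveProbVector p) {μ : Measure Plane} (hμ : IsSelfAffineMeasure Φ p μ)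
    (hatom : ∀ x, μ {x} = 0) (s : AffineSubspace ℝ Plane)
    (hs : Module.finrank ℝ s.direction = 1) : μ s = 0 := by
  by_contra hpos
  have huniq : ∀ s t : AffineSubspace ℝ Plane, Module.finrank ℝ s.direction = 1 →
      Module.finrank ℝ t.direction = 1 → ∀ x ∈ s, x ∈ t → ∀ y ∈ s, y ∈ t → x ≠ y → s = t := by
    have key : ∀ s : AffineSubspace ℝ Plane, Module.finrank ℝ s.direction = 1 →
        ∀ x ∈ s, ∀ y ∈ s, x ≠ y → s.direction = Submodule.span ℝ {y - x} := by
      intro s hs x hx y hy hxy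
      refine (Submodule.eq_of_le_of_finrank_eq ?_ ?_).symm
      · rw [Submodule.span_singleton_le_iff_mem]
        exact AffineSubspace.vsub_mem_direction hy hx
      · rw [hs, finrank_span_singleton (sub_ne_zero.2 hxy.symm)]
    intro s t hs ht x hxs hxt y hys hyt hxy
    exact AffineSubspace.ext_of_direction_eq
      ((key s hs x hxs y hys hxy).trans (key t ht x hxt y hyt hxy).symm) ⟨x, hxs, hxt⟩
  obtain ⟨S, hS, hSfin, ⟨C, hC⟩, -, -, hsurj⟩ := exists_finite_permuted_family hp hμ
    {C | ∃ s : AffineSubspace ℝ Plane, Module.finrank ℝ s.direction = 1 ∧ (s : Set Plane) = C}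
    (by rintro _ ⟨s, -, rfl⟩; exact s.closed_of_finiteDimensional)
    (by
      rintro i _ ⟨s, hs, rfl⟩
      refine ⟨s.map (Φ i).symm.toAffineMap, ?_, ?_⟩
      · rw [AffineSubspace.map_direction, ← hs]
        exact LinearEquiv.finrank_map_eq (Φ i).symm.linear _
      · ext x
        simp)
    (by
      rintro _ ⟨s, hs, rfl⟩ _ ⟨t, ht, rfl⟩ hst
      have hsub : ((s : Set Plane) ∩ t).Subsingleton := fun x hx y hy => by
        by_contra hxy
        exact hst (by rw [huniq s t hs ht x hx.1 hx.2 y hy.1 hy.2 hxy])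
      rcases hsub.eq_empty_or_singleton with h | ⟨x, h⟩
      · simp [h]
      · rw [h, hatom]) ⟨s, hs, rfl⟩ hpos
  refine hirr ⟨(fun s => s.direction) '' {s : AffineSubspace ℝ Plane | (s : Set Plane) ∈ S},
    (hSfin.preimage SetLike.coe_injective.injOn).image _, ?_, ?_, ?_⟩
  · obtain ⟨s, hs, rfl⟩ := hS hC
    exact ⟨_, s, hC, rfl⟩
  · rintro _ ⟨s, hs, rfl⟩
    obtain ⟨t, ht, hts⟩ := hS hs
    rwa [← SetLike.coe_injective hts]
  · rintro i _ ⟨s, hs, rfl⟩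
    obtain ⟨D, hD, hDs⟩ := hsurj i _ hs
    refine ⟨s.map (Φ i).toAffineMap, ?_, ?_⟩
    · have : ((s.map (Φ i).toAffineMap : AffineSubspace ℝ Plane) : Set Plane) = D := by
        rw [AffineSubspace.coe_map, ← hDs]
        exact Set.image_preimage_eq _ (Φ i).surjective
      simpa only [Set.mem_ofPred_eq, this] using hD
    · simp [AffineSubspace.map_direction]

/-! ### Quadratic functions and their leading forms -/

/-- Polynomial functions of degree at most two on the plane. -/
def IsQuadraticFunction (F : Plane → ℝ) : Prop :=
  ∃ a b c d e f : ℝ, ∀ x : Plane,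
    F x = a * x 0 ^ 2 + b * (x 0 * x 1) + c * x 1 ^ 2 + d * x 0 + e * x 1 + f

namespace IsQuadraticFunction

theorem add {F G : Plane → ℝ} (hF : IsQuadraticFunction F) (hG : IsQuadraticFunction G) :
    IsQuadraticFunction fun x => F x + G x := by
  obtain ⟨a, b, c, d, e, f, hF⟩ := hF
  obtain ⟨a', b', c', d', e', f', hG⟩ := hG
  exact ⟨a + a', b + b', c + c', d + d', e + e', f + f', fun x => by simp only [hF, hG]; ring⟩

theorem const_mul {F : Plane → ℝ} (hF : IsQuadraticFunction F) (k : ℝ) :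
    IsQuadraticFunction fun x => k * F x := by
  obtain ⟨a, b, c, d, e, f, hF⟩ := hF
  exact ⟨k * a, k * b, k * c, k * d, k * e, k * f, fun x => by simp only [hF]; ring⟩

theorem continuous {F : Plane → ℝ} (hF : IsQuadraticFunction F) : Continuous F := by
  obtain ⟨a, b, c, d, e, f, hF⟩ := hF
  rw [funext hF]
  fun_prop

theorem eval_mvPolynomial {P : MvPolynomial (Fin 2) ℝ} (hP : P.totalDegree ≤ 2) :
    IsQuadraticFunction fun x => MvPolynomial.eval (fun j => x j) P := by
  have hmono : ∀ m n : ℕ, m + n ≤ 2 → IsQuadraticFunction fun x => x 0 ^ m * x 1 ^ n := by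
    intro m n hmn
    have hm : m ≤ 2 := by omega
    have hn : n ≤ 2 := by omega
    interval_cases m <;> interval_cases n <;> first | omega | skip
    · exact ⟨0, 0, 0, 0, 0, 1, fun x => by ring⟩
    · exact ⟨0, 0, 0, 0, 1, 0, fun x => by ring⟩
    · exact ⟨0, 0, 1, 0, 0, 0, fun x => by ring⟩
    · exact ⟨0, 0, 0, 1, 0, 0, fun x => by ring⟩
    · exact ⟨0, 1, 0, 0, 0, 0, fun x => by ring⟩
    · exact ⟨1, 0, 0, 0, 0, 0, fun x => by ring⟩
  have hsum : ∀ s ⊆ P.support,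
      IsQuadraticFunction fun x : Plane => ∑ m ∈ s, P.coeff m * ∏ j, x j ^ m j := by
    intro s
    induction s using Finset.induction_on with
    | empty => exact fun _ => ⟨0, 0, 0, 0, 0, 0, fun x => by simp⟩
    | insert m s hm ih =>
      intro hs
      simp only [Finset.sum_insert hm, Fin.prod_univ_two]
      simp only [Fin.prod_univ_two] at ih
      refine ((hmono (m 0) (m 1) ?_).const_mul _).add
        (ih fun n hn => hs (Finset.mem_insert_of_mem hn))
      have := (MvPolynomial.le_totalDegree (hs (Finset.mem_insert_self m s))).trans hP
      rwa [Finsupp.sum_fintype _ _ (fun _ => rfl), Fin.sum_univ_two] at this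
  simpa only [MvPolynomial.eval_eq'] using hsum P.support subset_rfl

end IsQuadraticFunction

theorem AffineMap.apply_coord_eq (φ : Plane →ᵃ[ℝ] Plane) (x : Plane) (j : Fin 2) :
    φ x j = x 0 * φ.linear !₂[1, 0] j + x 1 * φ.linear !₂[0, 1] j + φ 0 j := by
  have hx : x = x 0 • !₂[1, 0] + x 1 • !₂[0, 1] := by
    ext k; fin_cases k <;> simp
  have h : φ x = φ.linear x + φ 0 := by
    simpa using φ.map_vadd 0 x
  rw [h]
  conv_lhs => rw [hx]
  simp only [map_add, map_smul, PiLp.add_apply, PiLp.smul_apply, smul_eq_mul]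

namespace IsQuadraticFunction

theorem comp_affine {F : Plane → ℝ} (hF : IsQuadraticFunction F) (φ : Plane →ᵃ[ℝ] Plane) :
    IsQuadraticFunction fun x => F (φ x) := by
  obtain ⟨a, b, c, d, e, f, hF⟩ := hF
  set p := φ.linear !₂[1, 0]
  set q := φ.linear !₂[0, 1]
  set r := φ 0
  refine ⟨a * p 0 ^ 2 + b * (p 0 * p 1) + c * p 1 ^ 2,
    a * (2 * p 0 * q 0) + b * (p 0 * q 1 + q 0 * p 1) + c * (2 * p 1 * q 1),
    a * q 0 ^ 2 + b * (q 0 * q 1) + c * q 1 ^ 2,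
    a * (2 * p 0 * r 0) + b * (p 0 * r 1 + r 0 * p 1) + c * (2 * p 1 * r 1) + d * p 0 + e * p 1,
    a * (2 * q 0 * r 0) + b * (q 0 * r 1 + r 0 * q 1) + c * (2 * q 1 * r 1) + d * q 0 + e * q 1,
    a * r 0 ^ 2 + b * (r 0 * r 1) + c * r 1 ^ 2 + d * r 0 + e * r 1 + f, fun x => ?_⟩
  simp only [hF, φ.apply_coord_eq x 0, φ.apply_coord_eq x 1]
  ring

end IsQuadraticFunction

/-- Twice the homogeneous part of degree two of a quadratic function. -/
def leadingForm (F : Plane → ℝ) (v : Plane) : ℝ := F v + F (-v) - 2 * F 0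

/-- Translations do not affect the degree-two part, so asymptotic directions are transported by the
linear part alone. -/
theorem leadingForm_comp_affine {F : Plane → ℝ} (hF : IsQuadraticFunction F)
    (φ : Plane →ᵃ[ℝ] Plane) (v : Plane) :
    leadingForm (fun x => F (φ x)) v = leadingForm F (φ.linear v) := by
  obtain ⟨a, b, c, d, e, f, hF⟩ := hF
  have h : ∀ x, φ x = φ.linear x + φ 0 := fun x => by simpa using φ.map_vadd 0 x
  simp only [leadingForm, h v, h (-v), hF, map_neg, PiLp.add_apply, PiLp.neg_apply, PiLp.zero_apply]
  ring

/-- An isotropic direction of a nonzero binary quadratic form is one of finitely many. -/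
theorem finite_isotropic_lines {a b c : ℝ} (h : ¬ (a = 0 ∧ b = 0 ∧ c = 0)) :
    {ℓ : Submodule ℝ Plane | Module.finrank ℝ ℓ = 1 ∧
      ∀ v ∈ ℓ, a * v 0 ^ 2 + b * (v 0 * v 1) + c * v 1 ^ 2 = 0}.Finite := by
  -- The form evaluated at `(1, t)`: its roots are the isotropic slopes. The vertical line is added
  -- separately.
  set q : Polynomial ℝ := Polynomial.C c * Polynomial.X ^ 2 + Polynomial.C b * Polynomial.X +
    Polynomial.C a
  have hq : q ≠ 0 := fun hq => h (by
    have h0 := congrArg (fun r => Polynomial.coeff r 0) hq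
    have h1 := congrArg (fun r => Polynomial.coeff r 1) hq
    have h2 := congrArg (fun r => Polynomial.coeff r 2) hq
    simp [q, Polynomial.coeff_X, Polynomial.coeff_C] at h0 h1 h2
    exact ⟨h0, h1, h2⟩)
  refine (((Polynomial.finite_setOfPred_isRoot hq).image
    fun t => Submodule.span ℝ {(!₂[1, t] : Plane)}).union
    (Set.finite_singleton (Submodule.span ℝ {(!₂[0, 1] : Plane)}))).subset ?_
  rintro ℓ ⟨hℓ, hv⟩
  have hspan : ∀ w ∈ ℓ, w ≠ 0 → Submodule.span ℝ {w} = ℓ := fun w hw hw0 =>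
    Submodule.eq_of_le_of_finrank_eq ((Submodule.span_singleton_le_iff_mem _ _).2 hw)
      (by rw [hℓ, finrank_span_singleton hw0])
  obtain ⟨v, hvℓ, hv0⟩ := ℓ.exists_mem_ne_zero_of_ne_bot (by rintro rfl; simp at hℓ)
  by_cases hx : v 0 = 0
  · right
    have hy : v 1 ≠ 0 := fun hy => hv0 (by ext k; fin_cases k <;> simp [hx, hy])
    refine (hspan _ ?_ fun h0 => ?_).symm
    · convert ℓ.smul_mem (v 1)⁻¹ hvℓ using 1
      ext k; fin_cases k <;> simp [hx, hy]
    · simpa using congrArg (fun w : Plane => w 1) h0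
  · left
    have hmem : (!₂[1, v 1 / v 0] : Plane) ∈ ℓ := by
      convert ℓ.smul_mem (v 0)⁻¹ hvℓ using 1
      ext k; fin_cases k <;> simp [hx, div_eq_inv_mul]
    refine ⟨v 1 / v 0, ?_, hspan _ hmem fun h0 => ?_⟩
    · have := hv _ hmem
      simp at this
      simp [q, Polynomial.IsRoot]
      linarith
    · simpa using congrArg (fun w : Plane => w 0) h0

/-- A quadratic function whose leading form is anisotropic has bounded zero set. -/
theorem isBounded_zero_of_anisotropic {F : Plane → ℝ} (hF : IsQuadraticFunction F)
    (han : ∀ v, leadingForm F v = 0 → v = 0) : Bornology.IsBounded {x | F x = 0} := by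
  obtain ⟨a, b, c, d, e, f, hF⟩ := hF
  have hlead : ∀ v, leadingForm F v = 2 * (a * v 0 ^ 2 + b * (v 0 * v 1) + c * v 1 ^ 2) := by
    intro v
    simp only [leadingForm, hF, PiLp.neg_apply, PiLp.zero_apply]
    ring
  have ha : a ≠ 0 := fun ha => by
    have := congrArg (fun w : Plane => w 0) (han !₂[1, 0] (by rw [hlead]; simp [ha]))
    simp at this
  have hdisc : b ^ 2 - 4 * a * c < 0 := by
    by_contra hd
    push Not at hd
    have hs := Real.sq_sqrt hd
    -- The quadratic formula gives an isotropic vector when the discriminant is nonnegative.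
    have := congrArg (fun w : Plane => w 1)
      (han !₂[-b + Real.sqrt (b ^ 2 - 4 * a * c), 2 * a] (by
        rw [hlead]; simp; linear_combination a * hs))
    simp [ha] at this
  set δ := 4 * a * c - b ^ 2
  have hδ : 0 < δ := by linarith
  set m := 4 * a * e - 2 * b * d
  set n := 4 * a * f - d ^ 2
  -- Beyond this bound on `|x 1|`, the term `δ * x 1 ^ 2` dominates `m * x 1 + n` in the completed
  -- square `hsq`. The summand `1` ensures `1 ≤ R`.
  set R := (|m| + |n|) / δ + 1
  set K := |m| * R + |n|
  have hR : 1 ≤ R := le_add_of_nonneg_left (by positivity)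
  refine isBounded_iff_forall_norm_le.2 ⟨(K + 1 + |b| * R + |d|) / |2 * a| + R, fun x hx => ?_⟩
  have hx' : F x = 0 := hx
  rw [hF] at hx'
  have hsq : (2 * a * x 0 + b * x 1 + d) ^ 2 + δ * x 1 ^ 2 + m * x 1 + n = 0 := by
    linear_combination 4 * a * hx'
  have hm : -(|m| * |x 1|) ≤ m * x 1 := by
    rw [← abs_mul]
    exact neg_abs_le _
  have hn := neg_abs_le n
  have hx1 : |x 1| ≤ R := by
    by_contra! hlt
    have h1 : |m| + |n| < δ * |x 1| := by
      have : (|m| + |n|) / δ < |x 1| := (lt_add_one _).trans hlt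
      rwa [div_lt_iff₀' hδ] at this
    have h2 : (|m| + |n|) * |x 1| < δ * |x 1| * |x 1| :=
      mul_lt_mul_of_pos_right h1 (by linarith)
    have h3 : |n| ≤ |n| * |x 1| := le_mul_of_one_le_right (abs_nonneg _) (by linarith)
    have h4 : δ * |x 1| * |x 1| = δ * x 1 ^ 2 := by rw [mul_assoc, abs_mul_abs_self]; ring
    nlinarith [sq_nonneg (2 * a * x 0 + b * x 1 + d)]
  have hK : |m| * |x 1| ≤ |m| * R := mul_le_mul_of_nonneg_left hx1 (abs_nonneg _)
  have hK0 : 0 ≤ K := by positivity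
  have hlin : |2 * a * x 0 + b * x 1 + d| ≤ K + 1 := by
    refine abs_le_of_sq_le_sq ?_ (by linarith)
    have : (2 * a * x 0 + b * x 1 + d) ^ 2 ≤ K := by
      have := mul_nonneg hδ.le (sq_nonneg (x 1))
      linarith
    nlinarith
  have hx0 : |x 0| ≤ (K + 1 + |b| * R + |d|) / |2 * a| := by
    rw [le_div_iff₀ (by positivity), ← abs_mul]
    calc |x 0 * (2 * a)| = |(2 * a * x 0 + b * x 1 + d) + -(b * x 1) + -d| := by congr 1; ring
      _ ≤ |2 * a * x 0 + b * x 1 + d| + |-(b * x 1)| + |-d| := abs_add_three _ _ _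
      _ ≤ K + 1 + |b| * R + |d| := by
        rw [abs_neg, abs_neg, abs_mul]
        gcongr
  calc ‖x‖ ≤ |x 0| + |x 1| := by
        rw [EuclideanSpace.norm_eq, Fin.sum_univ_two]
        refine Real.sqrt_le_iff.2 ⟨by positivity, ?_⟩
        simp only [Real.norm_eq_abs]
        nlinarith [mul_nonneg (abs_nonneg (x 0)) (abs_nonneg (x 1))]
    _ ≤ _ := add_le_add hx0 hx1

theorem linear_zero_subset_line {a b c : ℝ} (h : ¬ (a = 0 ∧ b = 0)) {x₀ : Plane}
    (hx₀ : a * x₀ 0 + b * x₀ 1 + c = 0) :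
    {x : Plane | a * x 0 + b * x 1 + c = 0} ⊆
      AffineSubspace.mk' x₀ (Submodule.span ℝ {(!₂[-b, a] : Plane)}) := by
  intro x (hx : a * x 0 + b * x 1 + c = 0)
  have hab : a ^ 2 + b ^ 2 ≠ 0 := fun h0 => h ⟨by nlinarith [sq_nonneg a, sq_nonneg b], by
    nlinarith [sq_nonneg a, sq_nonneg b]⟩
  rw [SetLike.mem_coe, AffineSubspace.mem_mk', Submodule.mem_span_singleton]
  refine ⟨(a * (x 1 - x₀ 1) - b * (x 0 - x₀ 0)) / (a ^ 2 + b ^ 2), ?_⟩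
  ext k
  fin_cases k
  · simp
    field_simp
    linear_combination a * (hx₀ - hx)
  · simp
    field_simp
    linear_combination b * (hx₀ - hx)

/-! ### Intersections of quadratic curves -/

section Null

variable {μ : Measure Plane}

theorem measure_linear_zero
    (hline : ∀ s : AffineSubspace ℝ Plane, Module.finrank ℝ s.direction = 1 → μ s = 0)
    {a b c : ℝ} (h : ¬ (a = 0 ∧ b = 0 ∧ c = 0)) :
    μ {x : Plane | a * x 0 + b * x 1 + c = 0} = 0 := by
  by_cases hab : a = 0 ∧ b = 0
  · have hc : c ≠ 0 := fun hc => h ⟨hab.1, hab.2, hc⟩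
    simp [hab.1, hab.2, hc]
  rcases Set.eq_empty_or_nonempty {x : Plane | a * x 0 + b * x 1 + c = 0} with h0 | ⟨x₀, hx₀⟩
  · simp [h0]
  refine measure_mono_null (linear_zero_subset_line hab hx₀) (hline _ ?_)
  rw [AffineSubspace.direction_mk', finrank_span_singleton]
  intro h0
  have h1 := congrArg (fun w : Plane => w 0) h0
  have h2 := congrArg (fun w : Plane => w 1) h0
  simp at h1 h2
  exact hab ⟨h2, h1⟩

/-- A quadratic function vanishing at three collinear points vanishes identically or its zero set
is covered by two lines. -/
theorem measure_zero_of_three_collinear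
    (hline : ∀ s : AffineSubspace ℝ Plane, Module.finrank ℝ s.direction = 1 → μ s = 0)
    {H : Plane → ℝ} (hH : IsQuadraticFunction H) (hne : ∃ x, H x ≠ 0) {o u : Plane} (hu : u ≠ 0)
    (h0 : H o = 0) (h1 : H (o + u) = 0) (h2 : H (o + (2 : ℝ) • u) = 0) :
    μ {x | H x = 0} = 0 := by
  obtain ⟨a, b, c, d, e, f, hH⟩ := hH
  set α := u 0
  set β := u 1
  set N := α ^ 2 + β ^ 2 with hNdef
  have hN : N ≠ 0 := fun h0 => hu (by
    have h3 : α = 0 := by nlinarith [sq_nonneg α, sq_nonneg β]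
    have h4 : β = 0 := by nlinarith [sq_nonneg α, sq_nonneg β]
    ext k; fin_cases k
    · exact h3
    · exact h4)
  have e0 := h0
  have e1 := h1
  have e2 := h2
  rw [hH] at e0 e1 e2
  simp only [PiLp.add_apply, PiLp.smul_apply, smul_eq_mul] at e0 e1 e2
  change a * (o 0 + α) ^ 2 + b * ((o 0 + α) * (o 1 + β)) + c * (o 1 + β) ^ 2 + d * (o 0 + α) +
    e * (o 1 + β) + f = 0 at e1
  change a * (o 0 + 2 * α) ^ 2 + b * ((o 0 + 2 * α) * (o 1 + 2 * β)) + c * (o 1 + 2 * β) ^ 2 +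
    d * (o 0 + 2 * α) + e * (o 1 + 2 * β) + f = 0 at e2
  -- `H (o + t • u)` is a quadratic polynomial in `t` with roots 0, 1, 2; `hA` and `hD` say that its
  -- upper coefficients vanish.
  have hA : a * α ^ 2 + b * (α * β) + c * β ^ 2 = 0 := by
    linear_combination (e2 - 2 * e1 + e0) / 2
  have hD : 2 * a * o 0 * α + b * (o 0 * β + o 1 * α) + 2 * c * o 1 * β + d * α + e * β = 0 := by
    linear_combination e1 - e0 - hA
  -- In the coordinates of `x - o` along `u` and along the normal `(-β, α)`, scaled by `N`, these
  -- are the coefficients of the mixed, normal-square and normal-linear terms. The others vanish, so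
  -- the normal coordinate factors out.
  set B := -2 * a * α * β + b * (α ^ 2 - β ^ 2) + 2 * c * α * β with hB
  set C := a * β ^ 2 - b * (α * β) + c * α ^ 2 with hC
  set E := -2 * a * o 0 * β + b * (o 0 * α - o 1 * β) + 2 * c * o 1 * α - d * β + e * α with hE
  have hfac : ∀ x : Plane, N ^ 2 * H x = (-β * x 0 + α * x 1 + (β * o 0 - α * o 1)) *
      ((B * α - C * β) * x 0 + (B * β + C * α) * x 1 +
        (E * N - B * (α * o 0 + β * o 1) + C * (β * o 0 - α * o 1))) := by
    intro x
    rw [hH]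
    linear_combination N ^ 2 * e0 + (α * (x 0 - o 0) + β * (x 1 - o 1)) ^ 2 * hA +
      N * (α * (x 0 - o 0) + β * (x 1 - o 1)) * hD
  refine measure_mono_null (t := {x : Plane | -β * x 0 + α * x 1 + (β * o 0 - α * o 1) = 0} ∪
    {x : Plane | (B * α - C * β) * x 0 + (B * β + C * α) * x 1 +
        (E * N - B * (α * o 0 + β * o 1) + C * (β * o 0 - α * o 1)) = 0}) ?_
      (measure_union_null (measure_linear_zero hline ?_) (measure_linear_zero hline ?_))
  · intro x (hx : H x = 0)
    have := hfac x
    rw [hx, mul_zero] at this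
    exact mul_eq_zero.1 this.symm
  · rintro ⟨h3, h4, -⟩
    exact hN (by rw [hNdef, h4, neg_eq_zero.1 h3]; ring)
  · rintro ⟨h3, h4, h5⟩
    obtain ⟨x, hx⟩ := hne
    have := hfac x
    rw [h3, h4, h5] at this
    simp [hN, hx] at this

/-- Two nonzero quadratic functions with non-null common zero set are proportional. -/
theorem proportional_of_common_zero
    (hline : ∀ s : AffineSubspace ℝ Plane, Module.finrank ℝ s.direction = 1 → μ s = 0)
    (hatom : ∀ x, μ {x} = 0)
    {F G : Plane → ℝ} (hF : IsQuadraticFunction F) (hG : IsQuadraticFunction G)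
    (hF0 : ∃ x, F x ≠ 0) (hG0 : ∃ x, G x ≠ 0) (hpos : μ ({x | F x = 0} ∩ {x | G x = 0}) ≠ 0) :
    ∃ k : ℝ, k ≠ 0 ∧ ∀ x, G x = k * F x := by
  have hnt : ¬ ({x | F x = 0} ∩ {x | G x = 0}).Subsingleton := fun hsub => hpos (by
    rcases hsub.eq_empty_or_singleton with h | ⟨x, h⟩
    · simp [h]
    · rw [h, hatom])
  obtain ⟨o, ho, y, hy, hoy⟩ := Set.not_subsingleton_iff.1 hnt
  -- A third point on the line through the common zeros `o` and `y`. A nontrivial combination of `F`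
  -- and `G` vanishing there too has three collinear zeros, so it is identically zero or has a null
  -- zero set.
  set z := o + (2 : ℝ) • (y - o)
  obtain ⟨s, t, hst, hz⟩ : ∃ s t : ℝ, (s ≠ 0 ∨ t ≠ 0) ∧ s * F z + t * G z = 0 := by
    by_cases h : F z = 0
    · exact ⟨1, 0, by simp, by simp [h]⟩
    · exact ⟨-G z, F z, Or.inr h, by ring⟩
  have hall : ∀ x, s * F x + t * G x = 0 := by
    by_contra hne
    push Not at hne
    refine hpos (measure_mono_null ?_ (measure_zero_of_three_collinear hline
      ((hF.const_mul s).add (hG.const_mul t)) hne (o := o) (u := y - o)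
      (sub_ne_zero.2 hoy.symm) ?_ ?_ hz))
    · rintro x ⟨hx, hx'⟩
      simp only [Set.mem_ofPred_eq] at hx hx' ⊢
      simp [hx, hx']
    · simp [ho.1.out, ho.2.out]
    · simp [hy.1.out, hy.2.out]
  obtain ⟨x, hx⟩ := hF0
  obtain ⟨y, hy⟩ := hG0
  have ht : t ≠ 0 := fun ht => by
    have := hall x
    simp_all
  have hs : s ≠ 0 := fun hs => by
    have := hall y
    simp_all
  refine ⟨-s / t, div_ne_zero (neg_ne_zero.2 hs) ht, fun x => ?_⟩
  field_simp
  linear_combination hall x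

end Null

/-! ### The main argument -/

theorem proposition5p6 {Λ : Type*} [Fintype Λ] (Φ : Λ → (Plane ≃ᵃ[ℝ] Plane))
    (hcontr : IsContractive Φ) (hfix : NoCommonFixedPoint Φ)
    (hnc : IsNonConformal Φ) (hirr : IsTotallyIrreducible Φ)
    (p : Λ → ℝ) (hp : IsPositiveProbVector p)
    (μ : Measure Plane) (hμ : IsSelfAffineMeasure Φ p μ)
    (C : Set Plane) (hC : IsQuadraticCurve C) :
    μ C = 0 := by
  have hatom := measure_singleton_eq_zero_of_isSelfAffine hcontr hfix hp hμ
  have hline := measure_line_eq_zero_of_isSelfAffine hirr hp hμ hatom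
  by_contra hpos
  obtain ⟨P, hP, hdeg, rfl⟩ := hC
  obtain ⟨S, hS, hSfin, ⟨C, hC⟩, hSpos, hstab, hsurj⟩ := exists_finite_permuted_family hp hμ
    {C | ∃ F, IsQuadraticFunction F ∧ (∃ x, F x ≠ 0) ∧ {x | F x = 0} = C}
    (by
      rintro _ ⟨F, hF, -, rfl⟩
      exact isClosed_eq hF.continuous continuous_const)
    (by
      rintro i _ ⟨F, hF, ⟨x, hx⟩, rfl⟩
      exact ⟨_, hF.comp_affine (Φ i).toAffineMap, ⟨(Φ i).symm x, by simpa using hx⟩, rfl⟩)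
    (by
      rintro _ ⟨F, hF, hF0, rfl⟩ _ ⟨G, hG, hG0, rfl⟩ hne
      by_contra h
      obtain ⟨k, hk, hGF⟩ := proportional_of_common_zero hline hatom hF hG hF0 hG0 h
      exact hne (by ext x; simp [hGF, hk]))
    ⟨_, IsQuadraticFunction.eval_mvPolynomial hdeg, by
      by_contra! h
      refine hP (MvPolynomial.funext fun v => ?_)
      simpa using h (WithLp.toLp 2 v), rfl⟩ hpos
  -- The asymptotic directions of the heaviest curves. Equations of one such curve are proportional,
  -- so the choice of `F` is immaterial.
  set T : Set (Submodule ℝ Plane) := {ℓ | Module.finrank ℝ ℓ = 1 ∧ ∃ F, IsQuadraticFunction F ∧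
    (∃ x, F x ≠ 0) ∧ {x | F x = 0} ∈ S ∧ ∀ v ∈ ℓ, leadingForm F v = 0} with hT
  have hTfin : T.Finite := by
    have hfin : ∀ D ∈ S, {ℓ : Submodule ℝ Plane | Module.finrank ℝ ℓ = 1 ∧
        ∃ F, IsQuadraticFunction F ∧ (∃ x, F x ≠ 0) ∧ {x | F x = 0} = D ∧
          ∀ v ∈ ℓ, leadingForm F v = 0}.Finite := by
      intro D hD
      obtain ⟨G, hG, hG0, rfl⟩ := hS hD
      obtain ⟨a, b, c, d, e, f, hGeq⟩ := id hG
      -- Otherwise the curve is contained in a line, which is null.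
      have hlead : ¬ (a = 0 ∧ b = 0 ∧ c = 0) := by
        rintro ⟨rfl, rfl, rfl⟩
        refine hSpos _ hD ?_
        have : ¬ (d = 0 ∧ e = 0 ∧ f = 0) := by
          rintro ⟨rfl, rfl, rfl⟩
          obtain ⟨x, hx⟩ := hG0
          exact hx (by rw [hGeq]; ring)
        simpa [hGeq] using measure_linear_zero hline this
      refine (finite_isotropic_lines hlead).subset ?_
      rintro ℓ ⟨hℓ, F, hF, hF0, hFG, hFℓ⟩
      obtain ⟨k, -, hk⟩ := proportional_of_common_zero hline hatom hF hG hF0 hG0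
        (by rw [hFG, Set.inter_self]; exact hSpos _ hD)
      refine ⟨hℓ, fun v hv => ?_⟩
      have h1 : leadingForm G v = k * leadingForm F v := by
        simp only [leadingForm, hk]
        ring
      rw [hFℓ v hv, mul_zero] at h1
      simp only [leadingForm, hGeq, PiLp.neg_apply, PiLp.zero_apply] at h1
      linear_combination h1 / 2
    refine (hSfin.biUnion hfin).subset ?_
    rintro ℓ ⟨hℓ, F, hF, hF0, hFS, hFℓ⟩
    exact Set.mem_biUnion hFS ⟨hℓ, F, hF, hF0, rfl, hFℓ⟩
  have hTempty : T = ∅ := by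
    by_contra hne
    refine hirr ⟨T, hTfin, Set.nonempty_iff_ne_empty.2 hne, fun ℓ hℓ => hℓ.1, ?_⟩
    rintro i ℓ ⟨hℓ, F, hF, ⟨x, hx⟩, hFS, hFℓ⟩
    -- The forward image of the curve is again in `S`, with equation `F` composed with the inverse
    -- map.
    obtain ⟨D, hD, hDF⟩ := hsurj i _ hFS
    refine ⟨(LinearEquiv.finrank_map_eq (Φ i).linear ℓ).trans hℓ, _,
      hF.comp_affine (Φ i).symm.toAffineMap, ⟨Φ i x, by simpa using hx⟩, ?_, ?_⟩
    · convert hD using 1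
      ext y
      have := Set.ext_iff.1 hDF ((Φ i).symm y)
      simpa using this.symm
    · rintro _ ⟨v, hv, rfl⟩
      rw [leadingForm_comp_affine hF]
      simpa using hFℓ v hv
  have hbdd : ∀ D ∈ S, Bornology.IsBounded D := by
    intro D hD
    obtain ⟨F, hF, hF0, rfl⟩ := hS hD
    refine isBounded_zero_of_anisotropic hF fun v hv => ?_
    by_contra hv0
    refine Set.eq_empty_iff_forall_notMem.1 hTempty (Submodule.span ℝ {v})
      ⟨finrank_span_singleton hv0, F, hF, hF0, hD, fun w hw => ?_⟩
    obtain ⟨t, rfl⟩ := Submodule.mem_span_singleton.1 hw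
    obtain ⟨a, b, c, d, e, f, hFeq⟩ := hF
    simp only [leadingForm, hFeq, PiLp.neg_apply, PiLp.zero_apply, PiLp.smul_apply,
      smul_eq_mul] at hv ⊢
    linear_combination t ^ 2 * hv
  obtain ⟨y, hy⟩ := nonempty_of_measure_ne_zero (hSpos C hC)
  refine hfix ⟨y, fun i => fixed_of_mem_bounded_backward_invariant hcontr (B := ⋃₀ S)
    ((Bornology.isBounded_sUnion hSfin).2 hbdd) ?_ ⟨C, hC, hy⟩ i⟩
  rintro j z ⟨D, hD, hz⟩
  exact ⟨_, hstab j D hD, by simpa using hz⟩
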